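/- Let $F \in \mathbb{R}^{d\times d}$ be symmetric positive semidefinite with rank $r$, and let $P \in \mathbb{R}^{m\times d}$ be a random matrix whose rows are $\frac{1}{\sqrt m} W_1^\top, \dots, \frac{1}{\sqrt m} W_m^\top$, where $W_1,\dots,W_m$ are i.i.d. random vectors in $\mathbb{R}^d$ with $\mathbb{E}[W_i]=0$, $\mathbb{E}[W_iW_i^\top]=I_d$, that are sub-Gaussian with parameter $c$: $\mathbb{E}[\exp(t\langle W_i,x\rangle)] \le \exp(ct^2/2)$ for all $t\in\mathbb{R}$ and all unit vectors $x$. For $\lambda\ge 0$ put $$\widetilde\tau_\lambda(g,g') = (Pg)^\top (PFP^\top+\lambda I_m)^{-1}(Pg'),$$ where the inverse denotes the Moore--Penrose pseudoinverse if the matrix is singular. There is a constant $C>0$ depending only on $c$ such that the following holds. Let $g'_1,\dots,g'_k\in\mathbb{R}^d$, let $g'_{j,\perp}$ be the orthogonal projection of $g'_j$ onto $\ker(F)$, and let $k'=\dim\operatorname{span}\{g'_{1,\perp},\dots,g'_{k,\perp}\}$. For any $\varepsilon,\delta\in(0,1)$, if $$m \ \ge\ C\,\frac{r+\min\{\log(k/\delta),\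 k'+\log(1/\delta)\}}{\varepsilon^2},$$ then with probability at least $1-\delta$, for all $g\in\operatorname{range}(F)$ and all $j\in\{1,\dots,k\}$ simultaneously: (i) (unregularized) $|\widetilde\tau_0(g,g'_{j,\perp})| \le \varepsilon\,\|g\|_2\,\|g'_{j,\perp}\|_2/\lambda^+_{\min}(F)$, where $\lambda^+_{\min}(F)$ is the smallest non-zero eigenvalue of $F$ (if $F=0$, then $g=0$ and both sides are read as $0$); (ii) (regularized) for every $\lambda>0$, $|\widetilde\tau_\lambda(g,g'_{j,\perp})| \le \varepsilon\,\|g\|_2\,\|g'_{j,\perp}\|_2\left(\frac1\lambda+\frac{2\|F\|_2}{\lambda^2}\right)$, where $\|F\|_2$ is the spectral norm. -/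

import Mathlib

open MeasureTheory ProbabilityTheory Matrix
open scoped NNReal ENNReal InnerProductSpace

/-- `B` satisfies the four Penrose equations for the real matrix `A`. -/
structure IsMoorePenrose {m n : Type*} [Fintype m] [Fintype n]
    (A : Matrix m n ℝ) (B : Matrix n m ℝ) : Prop where
  mul_mul_self : A * B * A = A
  self_mul_mul : B * A * B = B
  symm_left : (A * B)ᵀ = A * B
  symm_right : (B * A)ᵀ = B * A

/-- A matrix satisfying the Penrose equations for `A` is unique. -/
theorem IsMoorePenrose.unique {m n : Type*} [Fintype m] [Fintype n]
    {A : Matrix m n ℝ} {B C : Matrix n m ℝ}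
    (hB : IsMoorePenrose A B) (hC : IsMoorePenrose A C) : B = C := by
  have h1 : A * B = A * C := by
    calc A * B = (A * B)ᵀ := hB.symm_left.symm
      _ = ((A * C * A) * B)ᵀ := by rw [hC.mul_mul_self]
      _ = (A * B)ᵀ * (A * C)ᵀ := by rw [← transpose_mul, Matrix.mul_assoc (A * C)]
      _ = (A * B * A) * C := by
        rw [hB.symm_left, hC.symm_left, Matrix.mul_assoc (A * B) A C]
      _ = A * C := by rw [hB.mul_mul_self]
  have h2 : B * A = C * A := by
    calc B * A = (B * A)ᵀ := hB.symm_right.symm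
      _ = (B * (A * C * A))ᵀ := by rw [hC.mul_mul_self]
      _ = (C * A)ᵀ * (B * A)ᵀ := by rw [← transpose_mul]; simp only [Matrix.mul_assoc]
      _ = C * (A * B * A) := by
        rw [hB.symm_right, hC.symm_right]; simp only [Matrix.mul_assoc]
      _ = C * A := by rw [hB.mul_mul_self]
  calc B = B * A * B := hB.self_mul_mul.symm
    _ = C * (A * B) := by rw [h2, Matrix.mul_assoc]
    _ = C * A * C := by rw [h1, Matrix.mul_assoc]
    _ = C := hC.self_mul_mul

/-- Every real matrix has a Moore-Penrose inverse. -/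
theorem exists_isMoorePenrose {m n : Type*} [Fintype m] [Fintype n]
    (A : Matrix m n ℝ) : ∃ B, IsMoorePenrose A B := by
  classical
  have hB : IsSelfAdjoint (Aᵀ * A) := by
    rw [isSelfAdjoint_iff, star_eq_conjTranspose, conjTranspose_eq_transpose_of_trivial,
      transpose_mul, transpose_transpose]
  obtain ⟨C, hC⟩ : ∃ C : Matrix n n ℝ, C = cfc (fun x : ℝ => x⁻¹) (Aᵀ * A) := ⟨_, rfl⟩
  have hfin : (spectrum ℝ (Aᵀ * A)).Finite := Matrix.finite_real_spectrum
  have hcont : ∀ f : ℝ → ℝ, ContinuousOn f (spectrum ℝ (Aᵀ * A)) :=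
    fun f => hfin.continuousOn f
  have hCs : Cᵀ = C := by
    have h : IsSelfAdjoint C := by rw [hC]; exact cfc_predicate _ _
    rw [isSelfAdjoint_iff, star_eq_conjTranspose, conjTranspose_eq_transpose_of_trivial] at h
    exact h
  have hid : cfc (fun x : ℝ => x) (Aᵀ * A) = Aᵀ * A := cfc_id' ℝ (Aᵀ * A)
  have hCB : C * (Aᵀ * A) = cfc (fun x : ℝ => x⁻¹ * x) (Aᵀ * A) := by
    rw [cfc_mul _ _ _ (hcont _) (hcont _), hid, ← hC]
  have hBCB : Aᵀ * A * (C * (Aᵀ * A)) = Aᵀ * A := by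
    rw [hCB]
    nth_rewrite 1 [← hid]
    rw [← cfc_mul _ _ _ (hcont _) (hcont _)]
    refine Eq.trans ?_ hid
    congr 1
    funext x
    by_cases hx : x = 0
    · simp [hx]
    · field_simp
  have hCBC : C * (Aᵀ * A) * C = C := by
    rw [hCB, hC, ← cfc_mul _ _ _ (hcont _) (hcont _)]
    congr 1
    funext x
    by_cases hx : x = 0
    · simp [hx]
    · field_simp
  have hsym : (C * (Aᵀ * A))ᵀ = C * (Aᵀ * A) := by
    have h : IsSelfAdjoint (C * (Aᵀ * A)) := by rw [hCB]; exact cfc_predicate _ _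
    rw [isSelfAdjoint_iff, star_eq_conjTranspose, conjTranspose_eq_transpose_of_trivial] at h
    exact h
  have hACB : A * (C * (Aᵀ * A)) = A := by
    have h0 : A * (C * (Aᵀ * A)) - A = 0 := by
      rw [← conjTranspose_mul_self_eq_zero, conjTranspose_eq_transpose_of_trivial]
      have h1 : Aᵀ * (A * (C * (Aᵀ * A)) - A) = 0 := by
        rw [Matrix.mul_sub, ← Matrix.mul_assoc, hBCB, sub_self]
      have h2 : (A * (C * (Aᵀ * A)) - A)ᵀ = (C * (Aᵀ * A) - 1) * Aᵀ := by
        rw [transpose_sub, transpose_mul, hsym, Matrix.sub_mul, Matrix.one_mul]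
      rw [h2, Matrix.mul_assoc, h1, Matrix.mul_zero]
    exact sub_eq_zero.mp h0
  refine ⟨C * Aᵀ, ?_, ?_, ?_, ?_⟩
  · rw [Matrix.mul_assoc, Matrix.mul_assoc C, hACB]
  · rw [Matrix.mul_assoc C, ← Matrix.mul_assoc _ C, hCBC]
  · rw [← Matrix.mul_assoc, transpose_mul, transpose_mul, transpose_transpose, hCs,
      Matrix.mul_assoc]
  · rw [Matrix.mul_assoc, hsym]

/-- The Moore-Penrose pseudoinverse of a real matrix. -/
noncomputable def pinv {m n : Type*} [Fintype m] [Fintype n]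
    (A : Matrix m n ℝ) : Matrix n m ℝ :=
  (exists_isMoorePenrose A).choose

theorem pinv_isMoorePenrose {m n : Type*} [Fintype m] [Fintype n]
    (A : Matrix m n ℝ) : IsMoorePenrose A (pinv A) :=
  (exists_isMoorePenrose A).choose_spec

/-- On an invertible matrix the pseudoinverse is the inverse. -/
theorem pinv_eq_inv {n : Type*} [Fintype n] [DecidableEq n]
    (A : Matrix n n ℝ) (hA : IsUnit A.det) : pinv A = A⁻¹ := by
  refine (pinv_isMoorePenrose A).unique ⟨?_, ?_, ?_, ?_⟩ <;>
    simp [Matrix.mul_nonsing_inv A hA, Matrix.nonsing_inv_mul A hA]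

/-- The random vectors `W i` are independent copies of a centred isotropic random vector in `ℝ^d`
all of whose marginals `⟪W i, x⟫` along unit vectors `x` are sub-Gaussian with variance
proxy `c`. -/
structure IsIsotropicSubgaussianSample {Ω : Type*} [MeasurableSpace Ω] (μ : Measure Ω)
    {d m : ℕ} (c : ℝ≥0) (W : Fin m → Ω → EuclideanSpace ℝ (Fin d)) : Prop where
  measurable : ∀ i, Measurable (W i)
  indep : iIndepFun W μ
  identDistrib : ∀ i j, IdentDistrib (W i) (W j) μ μ
  mean_zero : ∀ i a, ∫ ω, W i ω a ∂μ = 0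
  isotropic : ∀ i a b, ∫ ω, W i ω a * W i ω b ∂μ = (1 : Matrix (Fin d) (Fin d) ℝ) a b
  subgaussian : ∀ i (x : EuclideanSpace ℝ (Fin d)), ‖x‖ = 1 →
    HasSubgaussianMGF (fun ω => ⟪W i ω, x⟫_ℝ) c μ

/-- The sketching matrix `P ∈ ℝ^{m × d}` whose `i`-th row is `w i / √m`. -/
noncomputable def sketchMatrix {d m : ℕ} (w : Fin m → EuclideanSpace ℝ (Fin d)) :
    Matrix (Fin m) (Fin d) ℝ :=
  Matrix.of fun i a => (1 / √(m : ℝ)) * w i a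

/-- The projected influence
`(P g)ᵀ (P F Pᵀ + lam I)⁻¹ (P g')`, the inverse being the Moore-Penrose pseudoinverse
(which is the matrix inverse whenever `P F Pᵀ + lam I` is invertible). -/
noncomputable def sketchedInfluence {d m : ℕ} (F : Matrix (Fin d) (Fin d) ℝ)
    (P : Matrix (Fin m) (Fin d) ℝ) (lam : ℝ) (g g' : EuclideanSpace ℝ (Fin d)) : ℝ :=
  (P *ᵥ g.ofLp) ⬝ᵥ
    (pinv (P * F * Pᵀ + lam • (1 : Matrix (Fin m) (Fin m) ℝ)) *ᵥ (P *ᵥ g'.ofLp))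

/-- The range of `F` as a subspace of Euclidean space. -/
noncomputable def rangeOf {d : ℕ} (F : Matrix (Fin d) (Fin d) ℝ) :
    Submodule ℝ (EuclideanSpace ℝ (Fin d)) :=
  LinearMap.range (Matrix.toEuclideanLin F)

/-- The kernel of `F` as a subspace of Euclidean space. -/
noncomputable def kerOf {d : ℕ} (F : Matrix (Fin d) (Fin d) ℝ) :
    Submodule ℝ (EuclideanSpace ℝ (Fin d)) :=
  LinearMap.ker (Matrix.toEuclideanLin F)

/-- The orthogonal projection of `v` onto `ker F`. -/
noncomputable def kerComponent {d : ℕ} (F : Matrix (Fin d) (Fin d) ℝ)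
    (v : EuclideanSpace ℝ (Fin d)) : EuclideanSpace ℝ (Fin d) :=
  (kerOf F).starProjection v

/-- The spectral norm of `F`. -/
noncomputable def spectralNorm2 {d : ℕ} (F : Matrix (Fin d) (Fin d) ℝ) : ℝ :=
  ‖Matrix.toEuclideanCLM (𝕜 := ℝ) F‖

/-- The smallest non-zero eigenvalue of a positive semidefinite matrix `F ≠ 0`: the infimum is over
a non-empty finite set, hence a minimum. -/
noncomputable def minPosEigenvalue {d : ℕ} (F : Matrix (Fin d) (Fin d) ℝ) : ℝ :=
  sInf {x : ℝ | x ≠ 0 ∧ Module.End.HasEigenvalue (Matrix.toEuclideanLin F) x}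

/-! A vector v in ker F is orthogonal to range F. If P preserves inner products up to ε/2 on a
subspace containing range F and v, then |⟪P u, P v⟫| ≤ (ε/2)‖u‖‖v‖ for all u in range F, and P
changes ‖u‖² by at most half. The influence is ⟪y, P v⟫ with y = (P F Pᵀ + λ)⁺ P g. The key point is
that y = P h for some h in range F, so only ‖h‖ has to be bounded: `abs_inner_le_of_regularized`
does this by an energy estimate, `abs_inner_le_of_unregularized` by the spectral gap of F.
`abs_sketchedInfluence_le` applies both to matrices.

Near-isometry holds with high probability: products of sub-Gaussian marginals are sub-exponential,
Bernstein's inequality treats a fixed pair of vectors, and a net extends the bound to a subspace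
(`exists_event_subspace`). The minimum in the bound on m reflects two coverings: one subspace of
dimension at most r + 1 per j with a union bound over k, or a single subspace of dimension at most r
+ k'. -/

section Deterministic

/-! ### Deterministic bounds for solutions of the normal equations -/

variable {E H : Type*} [NormedAddCommGroup E] [InnerProductSpace ℝ E]
  [NormedAddCommGroup H] [InnerProductSpace ℝ H]

/-- `T` is controlled only on `range A`, so `T'` alone has no useful bound. Pairing `A (T' y)` with
itself moves `T` onto a vector of `range A`. -/
theorem norm_apply_adjoint_le {A : E →ₗ[ℝ] E} (hA : A.IsSymmetric) {T : E →ₗ[ℝ] H}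
    {T' : H →ₗ[ℝ] E} (hT : ∀ x y, ⟪T x, y⟫_ℝ = ⟪x, T' y⟫_ℝ) {K : ℝ} (hK0 : 0 ≤ K)
    (hK : ∀ x, ‖A x‖ ≤ K * ‖x‖) {b : ℝ} (hb : 0 ≤ b)
    (hup : ∀ u ∈ LinearMap.range A, ‖T u‖ ≤ b * ‖u‖) (y : H) :
    ‖A (T' y)‖ ≤ b * K * ‖y‖ := by
  have h1 : ‖A (T' y)‖ ^ 2 ≤ b * K * ‖y‖ * ‖A (T' y)‖ := by
    calc ‖A (T' y)‖ ^ 2 = ⟪A (T' y), A (T' y)⟫_ℝ := (real_inner_self_eq_norm_sq _).symm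
      _ = ⟪T (A (A (T' y))), y⟫_ℝ := by rw [hT, hA (A (T' y)) (T' y)]
      _ ≤ ‖T (A (A (T' y)))‖ * ‖y‖ := real_inner_le_norm _ _
      _ ≤ b * (K * ‖A (T' y)‖) * ‖y‖ := by
        gcongr
        exact (hup _ ⟨_, rfl⟩).trans (by gcongr; exact hK _)
      _ = _ := by ring
  by_contra! h
  have h0 : 0 ≤ b * K * ‖y‖ := by positivity
  nlinarith [h0.trans_lt h]

/-- A solution `y` of the regularized normal equation pairs weakly with `T v` as soon as `T` nearly
preserves the norm on `range A` and nearly annihilates the pairing of `range A` with `v`. -/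
theorem abs_inner_le_of_regularized {A : E →ₗ[ℝ] E} (hA : A.IsPositive) {T : E →ₗ[ℝ] H}
    {T' : H →ₗ[ℝ] E} (hT : ∀ x y, ⟪T x, y⟫_ℝ = ⟪x, T' y⟫_ℝ) {K : ℝ} (hK0 : 0 ≤ K)
    (hK : ∀ x, ‖A x‖ ≤ K * ‖x‖) {η lam : ℝ} (hη : 0 ≤ η) (hlam : 0 < lam)
    (hup : ∀ u ∈ LinearMap.range A, ‖T u‖ ^ 2 ≤ 2 * ‖u‖ ^ 2) {v : E}
    (hv : ∀ u ∈ LinearMap.range A, |⟪T u, T v⟫_ℝ| ≤ η * ‖u‖ * ‖v‖) {g : E}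
    (hg : g ∈ LinearMap.range A) {y : H} (hy : T (A (T' y)) + lam • y = T g) :
    |⟪y, T v⟫_ℝ| ≤ η * ‖g‖ * ‖v‖ * (1 / lam + 2 * K / lam ^ 2) := by
  have hup' : ∀ u ∈ LinearMap.range A, ‖T u‖ ≤ √2 * ‖u‖ := fun u hu => by
    rw [← Real.sqrt_sq (norm_nonneg u), ← Real.sqrt_mul (by norm_num)]
    exact Real.le_sqrt_of_sq_le (hup u hu)
  -- Energy estimate: pair the equation with `y` and drop the nonnegative term `⟪A (T' y), T' y⟫`.
  have hyn : ‖y‖ ≤ √2 * ‖g‖ / lam := by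
    have h1 : lam * ‖y‖ ^ 2 ≤ ‖y‖ * (√2 * ‖g‖) := by
      have h2 : ⟪y, T (A (T' y)) + lam • y⟫_ℝ = ⟪A (T' y), T' y⟫_ℝ + lam * ‖y‖ ^ 2 := by
        rw [inner_add_right, inner_smul_right, real_inner_self_eq_norm_sq, real_inner_comm, hT]
      have h3 : 0 ≤ ⟪A (T' y), T' y⟫_ℝ := hA.inner_nonneg_left _
      have h4 : ⟪y, T g⟫_ℝ ≤ ‖y‖ * (√2 * ‖g‖) :=
        (real_inner_le_norm _ _).trans (by gcongr; exact hup' g hg)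
      rw [hy] at h2
      linarith
    rw [le_div_iff₀ hlam]
    by_contra! h
    have h0 : 0 ≤ √2 * ‖g‖ := by positivity
    have h5 : 0 < ‖y‖ := by
      by_contra! h6
      have := le_antisymm h6 (norm_nonneg y)
      rw [this] at h; linarith
    nlinarith
  have hAy := norm_apply_adjoint_le hA.isSymmetric hT hK0 hK (Real.sqrt_nonneg 2) hup' y
  -- Solving for `lam • y` exhibits `y` as the image of a vector of `range A`, to which `hv`
  -- applies.
  have hyh : y = T (lam⁻¹ • (g - A (T' y))) := by
    rw [map_smul, map_sub, ← hy, add_sub_cancel_left, smul_smul, inv_mul_cancel₀ hlam.ne', one_smul]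
  have hmem : lam⁻¹ • (g - A (T' y)) ∈ LinearMap.range A :=
    Submodule.smul_mem _ _ (Submodule.sub_mem _ hg ⟨_, rfl⟩)
  have hh : ‖lam⁻¹ • (g - A (T' y))‖ ≤ ‖g‖ * (1 / lam + 2 * K / lam ^ 2) := by
    rw [norm_smul, Real.norm_of_nonneg (by positivity)]
    have h1 : ‖g - A (T' y)‖ ≤ ‖g‖ + √2 * K * (√2 * ‖g‖ / lam) :=
      (norm_sub_le _ _).trans (by gcongr; exact hAy.trans (by gcongr))
    have h2 : √2 * K * (√2 * ‖g‖ / lam) = 2 * K * ‖g‖ / lam := by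
      have : √2 * √2 = 2 := Real.mul_self_sqrt (by norm_num)
      linear_combination (K * ‖g‖ / lam) * this
    rw [h2] at h1
    calc _ ≤ lam⁻¹ * (‖g‖ + 2 * K * ‖g‖ / lam) := by gcongr
      _ = _ := by field_simp
  calc |⟪y, T v⟫_ℝ| = |⟪T (lam⁻¹ • (g - A (T' y))), T v⟫_ℝ| := by rw [← hyh]
    _ ≤ η * ‖lam⁻¹ • (g - A (T' y))‖ * ‖v‖ := hv _ hmem
    _ ≤ η * (‖g‖ * (1 / lam + 2 * K / lam ^ 2)) * ‖v‖ := by gcongr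
    _ = _ := by ring

/-- The unregularized analogue, for `y` in the range of `T A T'` that solves the normal equation up
to an element of its kernel. -/
theorem abs_inner_le_of_unregularized {A : E →ₗ[ℝ] E} (hA : A.IsPositive)
    (hAker : ∀ x, ⟪A x, x⟫_ℝ = 0 → A x = 0) {T : E →ₗ[ℝ] H}
    {T' : H →ₗ[ℝ] E} (hT : ∀ x y, ⟪T x, y⟫_ℝ = ⟪x, T' y⟫_ℝ) {κ η : ℝ} (hκ : 0 < κ)
    (hAlow : ∀ x q, κ * ⟪A x, q⟫_ℝ ≤ ‖A x‖ * ‖A q‖) (hη : 0 ≤ η)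
    (hlow : ∀ u ∈ LinearMap.range A, ‖u‖ ^ 2 ≤ 2 * ‖T u‖ ^ 2) {v : E}
    (hv : ∀ u ∈ LinearMap.range A, |⟪T u, T v⟫_ℝ| ≤ η * ‖u‖ * ‖v‖) {g : E}
    (hg : g ∈ LinearMap.range A) {y z : H} (hyz : y = T (A (T' z)))
    (hy : T (A (T' (T (A (T' y))))) = T (A (T' (T g)))) :
    |⟪y, T v⟫_ℝ| ≤ 2 * η * (‖g‖ * ‖v‖ / κ) := by
  obtain ⟨w₀, rfl⟩ := hg
  -- The residual lies in the range of `T A` and in its orthogonal complement.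
  have hres : T (A (T' y)) = T (A w₀) := by
    have h1 : T (A (T' (T (A (w₀ - T' y))))) = 0 := by
      simp only [map_sub, hy, sub_self]
    have h2 : A (T' (T (A (w₀ - T' y)))) = 0 := by
      apply hAker
      rw [real_inner_comm, real_inner_comm, ← hT, h1, inner_zero_left]
    have h3 : T (A (w₀ - T' y)) = 0 := by
      rw [← inner_self_eq_zero (𝕜 := ℝ), hT, hA.isSymmetric, h2, inner_zero_right]
    rw [map_sub, map_sub, sub_eq_zero] at h3
    exact h3.symm
  have hinj : A (T' y) = A w₀ := by
    have h1 := hlow (A (T' y) - A w₀) (Submodule.sub_mem _ ⟨_, rfl⟩ ⟨_, rfl⟩)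
    rw [map_sub, hres, sub_self, norm_zero] at h1
    have h2 : ‖A (T' y) - A w₀‖ = 0 := by nlinarith [norm_nonneg (A (T' y) - A w₀)]
    exact sub_eq_zero.mp (norm_eq_zero.mp h2)
  -- With p = `A (T' z)`, so that y = T p: the gap gives κ‖y‖² ≤ ‖p‖‖A w₀‖, and `hlow` gives ‖p‖² ≤
  -- 2‖y‖².
  have hh : κ * ‖A (T' z)‖ ≤ 2 * ‖A w₀‖ := by
    have h1 := hAlow (T' z) (T' (T (A (T' z))))
    rw [← hyz, hinj, ← hT, ← hyz, real_inner_self_eq_norm_sq] at h1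
    have h2 := hlow (A (T' z)) ⟨_, rfl⟩
    rw [← hyz] at h2
    by_contra! h
    have h0 : 0 ≤ ‖A w₀‖ := norm_nonneg _
    have h3 : 0 < ‖A (T' z)‖ := by
      by_contra! h4
      rw [le_antisymm h4 (norm_nonneg _)] at h
      linarith
    nlinarith
  calc |⟪y, T v⟫_ℝ| = |⟪T (A (T' z)), T v⟫_ℝ| := by rw [← hyz]
    _ ≤ η * ‖A (T' z)‖ * ‖v‖ := hv _ ⟨_, rfl⟩
    _ ≤ η * (2 * ‖A w₀‖ / κ) * ‖v‖ := by
      gcongr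
      rw [le_div_iff₀ hκ]
      linarith
    _ = _ := by ring

end Deterministic

/-! ### Transfer to matrices and pseudoinverses -/

section Matrix

variable {d m : ℕ}

theorem inner_toEuclideanLin_transpose (P : Matrix (Fin m) (Fin d) ℝ)
    (x : EuclideanSpace ℝ (Fin d)) (y : EuclideanSpace ℝ (Fin m)) :
    ⟪toEuclideanLin P x, y⟫_ℝ = ⟪x, toEuclideanLin Pᵀ y⟫_ℝ := by
  rw [EuclideanSpace.inner_eq_star_dotProduct, EuclideanSpace.inner_eq_star_dotProduct]
  simp only [toLpLin_apply, star_trivial]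
  rw [Matrix.dotProduct_mulVec, ← Matrix.mulVec_transpose, dotProduct_comm]

theorem toEuclideanLin_mul_apply {n : ℕ} (P : Matrix (Fin m) (Fin d) ℝ)
    (Q : Matrix (Fin d) (Fin n) ℝ) (x : EuclideanSpace ℝ (Fin n)) :
    toEuclideanLin (P * Q) x = toEuclideanLin P (toEuclideanLin Q x) := by
  simp [toLpLin_apply, Matrix.mulVec_mulVec]

theorem norm_toEuclideanLin_le (F : Matrix (Fin d) (Fin d) ℝ) (x : EuclideanSpace ℝ (Fin d)) :
    ‖toEuclideanLin F x‖ ≤ spectralNorm2 F * ‖x‖ :=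
  (Matrix.toEuclideanCLM (𝕜 := ℝ) F).le_opNorm x

/-- The Penrose equations are stable under transposition, so uniqueness applies. -/
theorem IsMoorePenrose.transpose_eq {A B : Matrix (Fin m) (Fin m) ℝ} (hA : Aᵀ = A)
    (hB : IsMoorePenrose A B) : Bᵀ = B := by
  refine IsMoorePenrose.unique (A := A) ⟨?_, ?_, ?_, ?_⟩ hB
  · simpa [transpose_mul, hA, Matrix.mul_assoc] using congrArg transpose hB.mul_mul_self
  · simpa [transpose_mul, hA, Matrix.mul_assoc] using congrArg transpose hB.self_mul_mul
  · have h := hB.symm_right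
    rw [transpose_mul, hA] at h
    rw [h]
    exact hB.symm_right
  · have h := hB.symm_left
    rw [transpose_mul, hA] at h
    rw [h]
    exact hB.symm_left

theorem IsMoorePenrose.mul_comm {A B : Matrix (Fin m) (Fin m) ℝ} (hA : Aᵀ = A)
    (hB : IsMoorePenrose A B) : B * A = A * B := by
  rw [← hB.symm_right, transpose_mul, hA, hB.transpose_eq hA]

theorem eq_zero_of_inner_toEuclideanLin_eq_zero {F : Matrix (Fin d) (Fin d) ℝ}
    (hF : F.PosSemidef) (x : EuclideanSpace ℝ (Fin d)) (h : ⟪toEuclideanLin F x, x⟫_ℝ = 0) :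
    toEuclideanLin F x = 0 := by
  rw [real_inner_comm, EuclideanSpace.inner_eq_star_dotProduct] at h
  have h1 := (hF.dotProduct_mulVec_zero_iff x.ofLp).1 (by
    rw [dotProduct_comm] at h
    simpa [toLpLin_apply] using h)
  rw [toLpLin_apply, h1]
  rfl

theorem minPosEigenvalue_le {F : Matrix (Fin d) (Fin d) ℝ} (hF : F.PosSemidef) {x : ℝ}
    (hx : x ≠ 0) (h : Module.End.HasEigenvalue (toEuclideanLin F) x) :
    minPosEigenvalue F ≤ x :=
  csInf_le ⟨0, fun _ hy => eigenvalue_nonneg_of_nonneg hy.2 fun v =>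
    (isPositive_toEuclideanLin_iff.2 hF).re_inner_nonneg_right v⟩ ⟨hx, h⟩

theorem minPosEigenvalue_pos {F : Matrix (Fin d) (Fin d) ℝ} (hF : F.PosSemidef) (hF0 : F ≠ 0) :
    0 < minPosEigenvalue F := by
  have hne : {x : ℝ | x ≠ 0 ∧ Module.End.HasEigenvalue (toEuclideanLin F) x}.Nonempty := by
    by_contra hemp
    apply hF0
    have hs := (isPositive_toEuclideanLin_iff.2 hF).isSymmetric
    have h0 : toEuclideanLin F = 0 := by
      refine (hs.eigenvectorBasis finrank_euclideanSpace).toBasis.ext fun i => ?_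
      have h1 := hs.apply_eigenvectorBasis finrank_euclideanSpace i
      have h2 := hs.hasEigenvalue_eigenvalues finrank_euclideanSpace i
      have h3 : hs.eigenvalues finrank_euclideanSpace i = 0 := by
        by_contra h3
        exact hemp ⟨_, h3, h2⟩
      simp only [OrthonormalBasis.coe_toBasis, LinearMap.zero_apply]
      rw [h1, h3]
      simp
    simpa using h0
  have hfin : {x : ℝ | x ≠ 0 ∧ Module.End.HasEigenvalue (toEuclideanLin F) x}.Finite :=
    (Module.End.finite_hasEigenvalue (toEuclideanLin F)).subset fun x hx => hx.2
  have h := hne.csInf_mem hfin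
  exact lt_of_le_of_ne (eigenvalue_nonneg_of_nonneg h.2 fun v =>
    (isPositive_toEuclideanLin_iff.2 hF).re_inner_nonneg_right v) h.1.symm

/-- In an eigenbasis each eigenvalue ν satisfies κ|ν| ≤ ν², including ν = 0; Cauchy–Schwarz
finishes. This form of the spectral gap needs no inverse of F on its range. -/
theorem minPosEigenvalue_mul_inner_le {F : Matrix (Fin d) (Fin d) ℝ} (hF : F.PosSemidef)
    (hF0 : F ≠ 0) (x q : EuclideanSpace ℝ (Fin d)) :
    minPosEigenvalue F * ⟪toEuclideanLin F x, q⟫_ℝ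
      ≤ ‖toEuclideanLin F x‖ * ‖toEuclideanLin F q‖ := by
  have hpos := isPositive_toEuclideanLin_iff.2 hF
  have hs := hpos.isSymmetric
  let b := hs.eigenvectorBasis finrank_euclideanSpace
  let ν := hs.eigenvalues finrank_euclideanSpace
  have hb : ∀ i (w : EuclideanSpace ℝ (Fin d)),
      ⟪b i, toEuclideanLin F w⟫_ℝ = ν i * ⟪b i, w⟫_ℝ := fun i w => by
    rw [← hs (b i) w, hs.apply_eigenvectorBasis finrank_euclideanSpace i]
    simp [inner_smul_left, ν, b]
  have hν : ∀ i, minPosEigenvalue F * |ν i| ≤ |ν i| * |ν i| := fun i => by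
    by_cases h : ν i = 0
    · simp [h]
    · have h1 := minPosEigenvalue_le hF h (hs.hasEigenvalue_eigenvalues finrank_euclideanSpace i)
      gcongr
      exact h1.trans (le_abs_self _)
  calc minPosEigenvalue F * ⟪toEuclideanLin F x, q⟫_ℝ
      = ∑ i, minPosEigenvalue F * (ν i * ⟪b i, x⟫_ℝ * ⟪b i, q⟫_ℝ) := by
        rw [← b.sum_inner_mul_inner, Finset.mul_sum]
        refine Finset.sum_congr rfl fun i _ => ?_
        rw [real_inner_comm, hb]
    _ ≤ ∑ i, (|ν i| * |⟪b i, x⟫_ℝ|) * (|ν i| * |⟪b i, q⟫_ℝ|) := by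
        refine Finset.sum_le_sum fun i _ => ?_
        have h1 : ν i * ⟪b i, x⟫_ℝ * ⟪b i, q⟫_ℝ ≤ |ν i| * |⟪b i, x⟫_ℝ| * |⟪b i, q⟫_ℝ| := by
          rw [← abs_mul, ← abs_mul]; exact le_abs_self _
        have h2 := mul_le_mul_of_nonneg_right (hν i)
          (by positivity : 0 ≤ |⟪b i, x⟫_ℝ| * |⟪b i, q⟫_ℝ|)
        have h3 := mul_le_mul_of_nonneg_left h1 (minPosEigenvalue_pos hF hF0).le
        linarith
    _ ≤ √(∑ i, (|ν i| * |⟪b i, x⟫_ℝ|) ^ 2) * √(∑ i, (|ν i| * |⟪b i, q⟫_ℝ|) ^ 2) :=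
        Real.sum_mul_le_sqrt_mul_sqrt _ _ _
    _ = ‖toEuclideanLin F x‖ * ‖toEuclideanLin F q‖ := by
        have : ∀ w : EuclideanSpace ℝ (Fin d),
            √(∑ i, (|ν i| * |⟪b i, w⟫_ℝ|) ^ 2) = ‖toEuclideanLin F w‖ := fun w => by
          rw [← Real.sqrt_sq (norm_nonneg (toEuclideanLin F w)), ← b.sum_sq_norm_inner_right]
          congr 1
          refine Finset.sum_congr rfl fun i _ => ?_
          rw [hb, ← abs_mul, Real.norm_eq_abs]
        rw [this, this]

theorem sketchedInfluence_eq_inner {F : Matrix (Fin d) (Fin d) ℝ} (hF : F.PosSemidef)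
    (P : Matrix (Fin m) (Fin d) ℝ) (lam : ℝ) (g g' : EuclideanSpace ℝ (Fin d)) :
    sketchedInfluence F P lam g g' =
      ⟪toEuclideanLin (pinv (P * F * Pᵀ + lam • (1 : Matrix (Fin m) (Fin m) ℝ)))
        (toEuclideanLin P g), toEuclideanLin P g'⟫_ℝ := by
  have hFt : Fᵀ = F := by simpa using hF.isHermitian.eq
  have hM : (P * F * Pᵀ + lam • (1 : Matrix (Fin m) (Fin m) ℝ))ᵀ
      = P * F * Pᵀ + lam • (1 : Matrix (Fin m) (Fin m) ℝ) := by
    simp [transpose_mul, hFt, Matrix.mul_assoc]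
  rw [inner_toEuclideanLin_transpose, (pinv_isMoorePenrose _).transpose_eq hM,
    EuclideanSpace.inner_eq_star_dotProduct, dotProduct_comm]
  simp [sketchedInfluence, toLpLin_apply]

/-- The two influence bounds hold for any matrix that nearly preserves inner products on
`range F ⊔ span {v}`, where `v ∈ ker F`. -/
theorem abs_sketchedInfluence_le {F : Matrix (Fin d) (Fin d) ℝ} (hF : F.PosSemidef)
    {P : Matrix (Fin m) (Fin d) ℝ} {ε : ℝ} (hε0 : 0 < ε) (hε1 : ε < 1)
    {Y : Submodule ℝ (EuclideanSpace ℝ (Fin d))} (hY : rangeOf F ≤ Y)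
    (hP : ∀ x ∈ Y, ∀ y ∈ Y,
      |⟪toEuclideanLin P x, toEuclideanLin P y⟫_ℝ - ⟪x, y⟫_ℝ| ≤ ε / 2 * ‖x‖ * ‖y‖)
    {g v : EuclideanSpace ℝ (Fin d)} (hg : g ∈ rangeOf F) (hvY : v ∈ Y) (hv : v ∈ kerOf F) :
    |sketchedInfluence F P 0 g v| ≤ ε * (‖g‖ * ‖v‖ / minPosEigenvalue F) ∧
      ∀ lam : ℝ, 0 < lam → |sketchedInfluence F P lam g v|
        ≤ ε * ‖g‖ * ‖v‖ * (1 / lam + 2 * spectralNorm2 F / lam ^ 2) := by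
  have hpos := isPositive_toEuclideanLin_iff.2 hF
  have hsq : ∀ u ∈ rangeOf F, |‖toEuclideanLin P u‖ ^ 2 - ‖u‖ ^ 2| ≤ 1 / 2 * ‖u‖ ^ 2 := by
    intro u hu
    have := hP u (hY hu) u (hY hu)
    rw [real_inner_self_eq_norm_sq, real_inner_self_eq_norm_sq] at this
    refine this.trans ?_
    nlinarith [sq_nonneg ‖u‖]
  have hcross : ∀ u ∈ rangeOf F,
      |⟪toEuclideanLin P u, toEuclideanLin P v⟫_ℝ| ≤ ε / 2 * ‖u‖ * ‖v‖ := by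
    intro u hu
    have h0 : ⟪u, v⟫_ℝ = 0 := by
      obtain ⟨w, rfl⟩ := hu
      rw [hpos.isSymmetric, LinearMap.mem_ker.1 hv, inner_zero_right]
    simpa [h0] using hP u (hY hu) v hvY
  constructor
  -- For F = 0 the eigenvalue set is empty and its `sInf` is 0, so the bound reads 0 ≤ 0 because g =
  -- 0.
  · by_cases hF0 : F = 0
    · have hg0 : g = 0 := by
        obtain ⟨w, rfl⟩ := hg
        simp [hF0]
      simp [hg0, sketchedInfluence]
    have hFt : Fᵀ = F := by simpa using hF.isHermitian.eq
    rw [sketchedInfluence_eq_inner hF, zero_smul, add_zero]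
    obtain ⟨S, hSdef⟩ : ∃ S, S = P * F * Pᵀ := ⟨_, rfl⟩
    have hS : ∀ y, toEuclideanLin P (toEuclideanLin F (toEuclideanLin Pᵀ y))
        = toEuclideanLin S y := fun y => by
      rw [hSdef, toEuclideanLin_mul_apply, toEuclideanLin_mul_apply]
    have hSt : Sᵀ = S := by simp [hSdef, transpose_mul, hFt, Matrix.mul_assoc]
    rw [← hSdef]
    have hR := pinv_isMoorePenrose S
    have h := abs_inner_le_of_unregularized hpos (eq_zero_of_inner_toEuclideanLin_eq_zero hF)
      (inner_toEuclideanLin_transpose P) (minPosEigenvalue_pos hF hF0)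
      (minPosEigenvalue_mul_inner_le hF hF0) (by positivity)
      (fun u hu => by have := abs_le.1 (hsq u hu); linarith) hcross hg
      -- As S is symmetric, S⁺ commutes with S, so S⁺ = S S⁺ S⁺; this puts y in the range of S with
      -- preimage z.
      (y := toEuclideanLin (pinv S) (toEuclideanLin P g))
      (z := toEuclideanLin (pinv S) (toEuclideanLin (pinv S) (toEuclideanLin P g)))
      (by
        rw [hS, ← toEuclideanLin_mul_apply (pinv S) (pinv S), ← toEuclideanLin_mul_apply S,
          ← Matrix.mul_assoc, ← hR.mul_comm hSt, hR.self_mul_mul])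
      (by
        rw [hS, hS, hS, ← toEuclideanLin_mul_apply S (pinv S),
          ← toEuclideanLin_mul_apply S (S * pinv S), ← hR.mul_comm hSt, ← Matrix.mul_assoc, hR.mul_mul_self])
    calc _ ≤ _ := h
      _ = _ := by ring
  · intro lam hlam
    rw [sketchedInfluence_eq_inner hF]
    obtain ⟨M, hM⟩ : ∃ M, M = P * F * Pᵀ + lam • (1 : Matrix (Fin m) (Fin m) ℝ) := ⟨_, rfl⟩
    have hMpos : M.PosDef := by
      have h1 : (P * F * Pᵀ).PosSemidef := by simpa using hF.mul_mul_conjTranspose_same P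
      rw [hM]
      exact PosDef.posSemidef_add h1 (PosDef.one.smul hlam)
    rw [← hM, pinv_eq_inv M ((isUnit_iff_isUnit_det M).1 hMpos.isUnit)]
    have h := abs_inner_le_of_regularized hpos (inner_toEuclideanLin_transpose P)
      (norm_nonneg _) (norm_toEuclideanLin_le F) (η := ε / 2) (by positivity) hlam
      (fun u hu => by have := abs_le.1 (hsq u hu); nlinarith [sq_nonneg ‖u‖]) hcross hg
      (y := toEuclideanLin M⁻¹ (toEuclideanLin P g)) (by
        rw [← toEuclideanLin_mul_apply, ← toEuclideanLin_mul_apply]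
        have h1 : toEuclideanLin M (toEuclideanLin M⁻¹ (toEuclideanLin P g))
            = toEuclideanLin P g := by
          rw [← toEuclideanLin_mul_apply,
            mul_nonsing_inv M ((isUnit_iff_isUnit_det M).1 hMpos.isUnit)]
          simp [toLpLin_apply]
        conv_rhs => rw [← h1]
        conv_rhs => rw [hM]
        rw [map_add, map_smul, ← hM]
        simp [toLpLin_apply])
    rw [← spectralNorm2] at h
    refine h.trans ?_
    have : 0 ≤ spectralNorm2 F := norm_nonneg _
    gcongr
    linarith

end Matrix

/-! ### Nets and bilinear forms -/

section Net

variable {Y : Type*} [NormedAddCommGroup Y] [NormedSpace ℝ Y]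

/-- The unit ball of a finite-dimensional real normed space has a `1/2`-net with at most `5 ^ dim`
points. -/
theorem exists_half_net [FiniteDimensional ℝ Y] :
    ∃ N : Finset Y, N.card ≤ 5 ^ Module.finrank ℝ Y ∧ (∀ x ∈ N, ‖x‖ ≤ 1) ∧
      ∀ x : Y, ‖x‖ ≤ 1 → ∃ y ∈ N, ‖x - y‖ ≤ 1 / 2 := by
  classical
  -- A 1-separated subset of the ball of radius 2 of maximal cardinality, scaled by 1/2, is the net:
  -- a point `2 • x` at distance at least 1 from it could be added.
  let S : Set ℕ := {n | ∃ s : Finset Y, s.card = n ∧ (∀ c ∈ s, ‖c‖ ≤ 2) ∧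
    ∀ c ∈ s, ∀ d ∈ s, c ≠ d → 1 ≤ ‖c - d‖}
  have hne : S.Nonempty := ⟨0, ∅, by simp⟩
  have hbdd : BddAbove S := by
    refine ⟨5 ^ Module.finrank ℝ Y, ?_⟩
    rintro _ ⟨s, rfl, h1, h2⟩
    exact Besicovitch.card_le_of_separated s h1 h2
  obtain ⟨s, hs, h1, h2⟩ := Nat.sSup_mem hne hbdd
  refine ⟨s.image fun x => (1 / 2 : ℝ) • x, ?_, ?_, ?_⟩
  · exact Finset.card_image_le.trans (Besicovitch.card_le_of_separated s h1 h2)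
  · intro x hx
    obtain ⟨y, hy, rfl⟩ := Finset.mem_image.1 hx
    have := h1 y hy
    rw [norm_smul]
    norm_num
    linarith
  · intro x hx
    obtain ⟨y, hy, hxy⟩ : ∃ y ∈ s, ‖(2 : ℝ) • x - y‖ < 1 := by
      by_contra! h
      have hx2 : ‖(2 : ℝ) • x‖ ≤ 2 := by
        rw [norm_smul]; norm_num; exact hx
      have hmem : (2 : ℝ) • x ∉ s := fun hm => by
        have := h _ hm
        simp at this
        linarith
      have : s.card + 1 ∈ S := by
        refine ⟨insert ((2 : ℝ) • x) s, Finset.card_insert_of_notMem hmem, ?_, ?_⟩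
        · intro c hc
          rcases Finset.mem_insert.1 hc with rfl | hc
          exacts [hx2, h1 c hc]
        · intro c hc e he hce
          rcases Finset.mem_insert.1 hc with rfl | hc <;>
            rcases Finset.mem_insert.1 he with rfl | he
          · exact absurd rfl hce
          · exact h e he
          · rw [norm_sub_rev]; exact h c hc
          · exact h2 c hc e he hce
      have := le_csSup hbdd this
      omega
    refine ⟨_, Finset.mem_image_of_mem _ hy, ?_⟩
    have : x - (1 / 2 : ℝ) • y = (1 / 2 : ℝ) • ((2 : ℝ) • x - y) := by
      rw [smul_sub, smul_smul]; norm_num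
    rw [this, norm_smul]
    norm_num
    linarith

/-- Approximating a unit vector by a net point gives ‖f‖ ≤ a + ‖f‖/2, and the last term is absorbed.
-/
theorem opNorm_le_of_half_net {G : Type*} [SeminormedAddCommGroup G] [NormedSpace ℝ G]
    {N : Finset Y} (hN : ∀ x : Y, ‖x‖ ≤ 1 → ∃ y ∈ N, ‖x - y‖ ≤ 1 / 2) (f : Y →L[ℝ] G) {a : ℝ}
    (hf : ∀ x ∈ N, ‖f x‖ ≤ a) : ‖f‖ ≤ 2 * a := by
  have ha : 0 ≤ a := by
    obtain ⟨y, hy, -⟩ := hN 0 (by simp)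
    exact (norm_nonneg _).trans (hf y hy)
  have h : ‖f‖ ≤ a + ‖f‖ * (1 / 2) := by
    refine f.opNorm_le_of_unit_norm (by positivity) fun x hx => ?_
    obtain ⟨y, hy, hxy⟩ := hN x hx.le
    calc ‖f x‖ = ‖f y + f (x - y)‖ := by rw [← map_add, add_sub_cancel]
      _ ≤ ‖f y‖ + ‖f (x - y)‖ := norm_add_le _ _
      _ ≤ a + ‖f‖ * (1 / 2) := by
        gcongr
        · exact hf y hy
        · exact (f.le_opNorm _).trans (by gcongr)
  linarith

/-- The net argument is used twice, for each `B x` and for `B` as a map into the dual; hence 4 = 2 ·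
2. -/
theorem abs_bilin_le_of_half_net {N : Finset Y}
    (hN : ∀ x : Y, ‖x‖ ≤ 1 → ∃ y ∈ N, ‖x - y‖ ≤ 1 / 2) (B : Y →L[ℝ] Y →L[ℝ] ℝ) {a : ℝ}
    (hB : ∀ x ∈ N, ∀ y ∈ N, |B x y| ≤ a) (x y : Y) : |B x y| ≤ 4 * a * ‖x‖ * ‖y‖ := by
  have h : ‖B‖ ≤ 2 * (2 * a) :=
    opNorm_le_of_half_net hN B fun x hx => opNorm_le_of_half_net hN (B x) (hB x hx)
  calc |B x y| ≤ ‖B‖ * ‖x‖ * ‖y‖ := B.le_opNorm₂ x y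
    _ ≤ 2 * (2 * a) * ‖x‖ * ‖y‖ := by gcongr
    _ = _ := by ring

end Net

/-! ### Sub-exponential moments and Bernstein's inequality -/

section Concentration

variable {Ω : Type*} [MeasurableSpace Ω] {μ : Measure Ω}

theorem lintegral_exp_mul_gaussianReal (t : ℝ) :
    ∫⁻ x, ENNReal.ofReal (Real.exp (t * x)) ∂(gaussianReal 0 1)
      = ENNReal.ofReal (Real.exp (t ^ 2 / 2)) := by
  rw [← ofReal_integral_eq_lintegral_ofReal (integrable_exp_mul_gaussianReal t)
    (ae_of_all _ fun _ => (Real.exp_pos _).le)]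
  have := congrFun (mgf_id_gaussianReal (μ := 0) (v := 1)) t
  simp only [mgf, id] at this
  rw [this]
  simp

/-- The integrand times the N(0, 1) density is √2 times the N(0, 2) density. -/
theorem lintegral_exp_sq_gaussianReal :
    ∫⁻ x, ENNReal.ofReal (Real.exp (x ^ 2 / 4)) ∂(gaussianReal 0 1) = ENNReal.ofReal √2 := by
  rw [gaussianReal_of_var_ne_zero _ one_ne_zero,
    lintegral_withDensity_eq_lintegral_mul _ (measurable_gaussianPDF 0 1) (by fun_prop)]
  have h : ∀ x : ℝ, (gaussianPDF 0 1 * fun x : ℝ => ENNReal.ofReal (Real.exp (x ^ 2 / 4))) x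
      = ENNReal.ofReal √2 * gaussianPDF 0 2 x := by
    intro x
    simp only [Pi.mul_apply, gaussianPDF]
    rw [← ENNReal.ofReal_mul (gaussianPDFReal_nonneg _ _ _), ← ENNReal.ofReal_mul (by positivity)]
    congr 1
    simp only [gaussianPDFReal, NNReal.coe_one, NNReal.coe_ofNat, sub_zero, mul_one]
    rw [mul_assoc, ← Real.exp_add, ← mul_assoc]
    have h1 : -x ^ 2 / 2 + x ^ 2 / 4 = -x ^ 2 / (2 * 2) := by ring
    have h2 : (√(2 * Real.pi))⁻¹ = √2 * (√(2 * Real.pi * 2))⁻¹ := by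
      rw [Real.sqrt_mul (by positivity) (2 : ℝ)]
      field_simp
    rw [h1, h2]
  simp_rw [h]
  rw [lintegral_const_mul _ (measurable_gaussianPDF 0 2), lintegral_gaussianPDF_eq_one _ two_ne_zero,
    mul_one]

/-- The square of a sub-Gaussian variable has a finite exponential moment, obtained by averaging the
moment generating function against a Gaussian. -/
theorem lintegral_exp_mul_sq_le [SFinite μ] {X : Ω → ℝ} {c : ℝ≥0} (hX : HasSubgaussianMGF X c μ)
    (hXm : Measurable X) {b : ℝ} (hb : 0 ≤ b) (hbc : b * c ≤ 1 / 4) :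
    ∫⁻ ω, ENNReal.ofReal (Real.exp (b * X ω ^ 2)) ∂μ ≤ ENNReal.ofReal √2 := by
  have hs : √(2 * b) ^ 2 = 2 * b := Real.sq_sqrt (by positivity)
  calc ∫⁻ ω, ENNReal.ofReal (Real.exp (b * X ω ^ 2)) ∂μ
      -- Linearize the square: exp(b X²) is the Gaussian average of exp(√(2b) X t). After Tonelli,
      -- the sub-Gaussian bound is exp(b c t²) ≤ exp(t²/4).
      = ∫⁻ ω, ∫⁻ t, ENNReal.ofReal (Real.exp (√(2 * b) * X ω * t)) ∂(gaussianReal 0 1) ∂μ := by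
        refine lintegral_congr fun ω => ?_
        rw [lintegral_exp_mul_gaussianReal, mul_pow, hs]
        congr 2
        ring
    _ = ∫⁻ t, ∫⁻ ω, ENNReal.ofReal (Real.exp (√(2 * b) * X ω * t)) ∂μ ∂(gaussianReal 0 1) := by
        refine lintegral_lintegral_swap (Measurable.aemeasurable ?_)
        fun_prop
    _ ≤ ∫⁻ t, ENNReal.ofReal (Real.exp (t ^ 2 / 4)) ∂(gaussianReal 0 1) := by
        refine lintegral_mono fun t => ?_
        have h1 : ∀ ω, √(2 * b) * X ω * t = (√(2 * b) * t) * X ω := fun ω => by ring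
        simp_rw [h1]
        rw [← ofReal_integral_eq_lintegral_ofReal (hX.integrable_exp_mul _)
          (ae_of_all _ fun _ => (Real.exp_pos _).le)]
        refine ENNReal.ofReal_le_ofReal ((hX.mgf_le _).trans (Real.exp_le_exp.2 ?_))
        rw [mul_pow, hs]
        nlinarith [sq_nonneg t]
    _ = ENNReal.ofReal √2 := lintegral_exp_sq_gaussianReal

/-- The second-order Taylor remainder is at most |s z|² exp |s z|. One half of exp(b|z|) absorbs z²,
the other absorbs exp |s z|. -/
theorem exp_mul_le_of_abs_le {b s : ℝ} (hb : 0 < b) (hs : |s| ≤ b / 2) (z : ℝ) :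
    Real.exp (s * z) ≤ 1 + s * z + 8 * s ^ 2 / b ^ 2 * Real.exp (b * |z|) := by
  have h1 : Real.exp (s * z) - (1 + s * z) ≤ |s * z| ^ 2 * Real.exp |s * z| := by
    have := Complex.norm_exp_sub_sum_le_norm_mul_exp ((s * z : ℝ) : ℂ) 2
    rw [Complex.norm_real, Real.norm_eq_abs] at this
    have h2 : Complex.exp ((s * z : ℝ) : ℂ)
        - ∑ i ∈ Finset.range 2, ((s * z : ℝ) : ℂ) ^ i / (i.factorial : ℂ)
        = ((Real.exp (s * z) - (1 + s * z) : ℝ) : ℂ) := by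
      simp [Finset.sum_range_succ]
    rw [h2, Complex.norm_real] at this
    exact (le_abs_self _).trans this
  have h2 : |s * z| ≤ b / 2 * |z| := by rw [abs_mul]; gcongr
  have h3 : z ^ 2 ≤ 8 / b ^ 2 * Real.exp (b / 2 * |z|) := by
    have := Real.quadratic_le_exp_of_nonneg (by positivity : 0 ≤ b / 2 * |z|)
    have h4 : (b / 2 * |z|) ^ 2 / 2 = b ^ 2 / 8 * z ^ 2 := by
      rw [mul_pow, sq_abs]; ring
    have h5 : b ^ 2 / 8 * z ^ 2 ≤ Real.exp (b / 2 * |z|) := by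
      have : 0 ≤ b / 2 * |z| := by positivity
      linarith
    calc z ^ 2 = 8 / b ^ 2 * (b ^ 2 / 8 * z ^ 2) := by field_simp
      _ ≤ _ := by gcongr
  have h6 : |s * z| ^ 2 * Real.exp |s * z|
      ≤ s ^ 2 * (8 / b ^ 2 * Real.exp (b / 2 * |z|)) * Real.exp (b / 2 * |z|) := by
    rw [sq_abs, mul_pow]
    gcongr
  have h7 : s ^ 2 * (8 / b ^ 2 * Real.exp (b / 2 * |z|)) * Real.exp (b / 2 * |z|)
      = 8 * s ^ 2 / b ^ 2 * Real.exp (b * |z|) := by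
    have : Real.exp (b * |z|) = Real.exp (b / 2 * |z|) * Real.exp (b / 2 * |z|) := by
      rw [← Real.exp_add]; congr 1; ring
    rw [this]; ring
  linarith

/-- Integrating the pointwise bound kills the linear term by centring; then 1 + x ≤ exp x. -/
theorem integrable_exp_mul_and_mgf_le [IsProbabilityMeasure μ] {Z : Ω → ℝ} (hZ : Integrable Z μ)
    (hZ0 : ∫ ω, Z ω ∂μ = 0) {b K s : ℝ} (hb : 0 < b)
    (hint : Integrable (fun ω => Real.exp (b * |Z ω|)) μ)
    (hK : ∫ ω, Real.exp (b * |Z ω|) ∂μ ≤ K) (hs : |s| ≤ b / 2) :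
    Integrable (fun ω => Real.exp (s * Z ω)) μ ∧
      mgf Z μ s ≤ Real.exp (8 * K * s ^ 2 / b ^ 2) := by
  have hlin : Integrable (fun ω => 1 + s * Z ω) μ := (integrable_const _).add (hZ.const_mul s)
  have hdom : Integrable
      (fun ω => 1 + s * Z ω + 8 * s ^ 2 / b ^ 2 * Real.exp (b * |Z ω|)) μ :=
    hlin.add (hint.const_mul _)
  have hI : Integrable (fun ω => Real.exp (s * Z ω)) μ := by
    refine hdom.mono' ?_ (ae_of_all _ fun ω => ?_)
    · exact Real.continuous_exp.comp_aestronglyMeasurable (hZ.aestronglyMeasurable.const_mul s)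
    · rw [Real.norm_of_nonneg (Real.exp_pos _).le]
      exact exp_mul_le_of_abs_le hb hs _
  refine ⟨hI, ?_⟩
  calc mgf Z μ s ≤ ∫ ω, (1 + s * Z ω + 8 * s ^ 2 / b ^ 2 * Real.exp (b * |Z ω|)) ∂μ :=
        integral_mono hI hdom fun ω => exp_mul_le_of_abs_le hb hs _
    _ = 1 + 8 * s ^ 2 / b ^ 2 * ∫ ω, Real.exp (b * |Z ω|) ∂μ := by
        rw [integral_add hlin (hint.const_mul _),
          integral_add (integrable_const _) (hZ.const_mul s), integral_const_mul, hZ0,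
          integral_const_mul]
        simp
    _ ≤ 1 + 8 * s ^ 2 / b ^ 2 * K := by gcongr
    _ ≤ Real.exp (8 * K * s ^ 2 / b ^ 2) := by
        have := Real.add_one_le_exp (8 * K * s ^ 2 / b ^ 2)
        have h : 8 * s ^ 2 / b ^ 2 * K = 8 * K * s ^ 2 / b ^ 2 := by ring
        linarith

/-- Bernstein's inequality for sums of independent centred sub-exponential variables. -/
theorem measureReal_sum_ge_le [IsProbabilityMeasure μ] {m : ℕ} {Z : Fin m → Ω → ℝ}
    (hindep : iIndepFun Z μ) (hm : ∀ i, Measurable (Z i)) (hZ : ∀ i, Integrable (Z i) μ)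
    (hZ0 : ∀ i, ∫ ω, Z i ω ∂μ = 0) {b K a : ℝ} (hb : 0 < b) (hb1 : b ≤ 1) (hK1 : 1 ≤ K)
    (hint : ∀ i, Integrable (fun ω => Real.exp (b * |Z i ω|)) μ)
    (hK : ∀ i, ∫ ω, Real.exp (b * |Z i ω|) ∂μ ≤ K) (ha : 0 ≤ a) (ha1 : a ≤ 1) :
    μ.real {ω | m * a ≤ ∑ i, Z i ω} ≤ Real.exp (-(m * (a ^ 2 * b ^ 2 / (32 * K)))) := by
  -- The minimizer of -s a + 8 K s² / b², the Chernoff exponent per summand.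
  obtain ⟨s, hsdef⟩ : ∃ s, s = a * b ^ 2 / (16 * K) := ⟨_, rfl⟩
  have hK0 : 0 < K := by linarith
  have hs0 : 0 ≤ s := by rw [hsdef]; positivity
  have hs : |s| ≤ b / 2 := by
    rw [abs_of_nonneg hs0, hsdef, div_le_div_iff₀ (by positivity) (by norm_num)]
    have : a * b ≤ 1 := mul_le_one₀ ha1 hb.le hb1
    nlinarith
  have hmgf := fun i => integrable_exp_mul_and_mgf_le (hZ i) (hZ0 i) hb (hint i) (hK i) hs
  have hsum : Integrable (fun ω => Real.exp (s * (∑ i, Z i) ω)) μ :=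
    hindep.integrable_exp_mul_sum hm fun i _ => (hmgf i).1
  have h := measure_ge_le_exp_mul_mgf (μ := μ) (X := ∑ i, Z i) (m * a) hs0 hsum
  simp only [Finset.sum_apply] at h
  refine h.trans ?_
  rw [hindep.mgf_sum hm]
  calc Real.exp (-s * (m * a)) * ∏ i, mgf (Z i) μ s
      ≤ Real.exp (-s * (m * a)) * ∏ _i : Fin m, Real.exp (8 * K * s ^ 2 / b ^ 2) := by
        gcongr with i
        · exact fun _ _ => mgf_nonneg
        · exact (hmgf i).2
    _ = Real.exp (-(m * (a ^ 2 * b ^ 2 / (32 * K)))) := by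
        rw [Finset.prod_const, Finset.card_univ, Fintype.card_fin, ← Real.exp_nat_mul,
          ← Real.exp_add]
        congr 1
        rw [hsdef]
        field_simp
        ring

theorem measureReal_abs_sum_ge_le [IsProbabilityMeasure μ] {m : ℕ} {Z : Fin m → Ω → ℝ}
    (hindep : iIndepFun Z μ) (hm : ∀ i, Measurable (Z i)) (hZ : ∀ i, Integrable (Z i) μ)
    (hZ0 : ∀ i, ∫ ω, Z i ω ∂μ = 0) {b K a : ℝ} (hb : 0 < b) (hb1 : b ≤ 1) (hK1 : 1 ≤ K)
    (hint : ∀ i, Integrable (fun ω => Real.exp (b * |Z i ω|)) μ)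
    (hK : ∀ i, ∫ ω, Real.exp (b * |Z i ω|) ∂μ ≤ K) (ha : 0 ≤ a) (ha1 : a ≤ 1) :
    μ.real {ω | m * a ≤ |∑ i, Z i ω|} ≤ 2 * Real.exp (-(m * (a ^ 2 * b ^ 2 / (32 * K)))) := by
  have h1 := measureReal_sum_ge_le hindep hm hZ hZ0 hb hb1 hK1 hint hK ha ha1
  have h2 := measureReal_sum_ge_le (Z := fun i ω => -Z i ω)
    (hindep.comp (fun _ x => -x) fun _ => measurable_neg) (fun i => (hm i).neg)
    (fun i => (hZ i).neg) (fun i => by rw [integral_neg, hZ0, neg_zero]) hb hb1 hK1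
    (by simpa using hint) (by simpa using hK) ha ha1
  have hsub : {ω | m * a ≤ |∑ i, Z i ω|}
      ⊆ {ω | m * a ≤ ∑ i, Z i ω} ∪ {ω | m * a ≤ ∑ i, -Z i ω} := by
    intro ω hω
    simpa [le_abs] using hω
  calc _ ≤ _ := measureReal_mono hsub
    _ ≤ _ := measureReal_union_le _ _
    _ ≤ _ := by linarith

end Concentration

/-! ### Concentration of the sketch on subspaces -/

theorem inner_sketchMatrix {d m : ℕ} (w : Fin m → EuclideanSpace ℝ (Fin d))
    (x y : EuclideanSpace ℝ (Fin d)) :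
    ⟪toEuclideanLin (sketchMatrix w) x, toEuclideanLin (sketchMatrix w) y⟫_ℝ
      = 1 / m * ∑ i, ⟪w i, x⟫_ℝ * ⟪w i, y⟫_ℝ := by
  have h : ∀ (x : EuclideanSpace ℝ (Fin d)) i,
      (toEuclideanLin (sketchMatrix w) x) i = 1 / √(m : ℝ) * ⟪w i, x⟫_ℝ := fun x i => by
    rw [toLpLin_apply]
    simp only [mulVec, dotProduct, sketchMatrix, of_apply, PiLp.inner_apply, Finset.mul_sum]
    refine Finset.sum_congr rfl fun a _ => ?_
    simp only [RCLike.inner_apply, conj_trivial]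
    ring
  rw [PiLp.inner_apply, Finset.mul_sum]
  refine Finset.sum_congr rfl fun i _ => ?_
  rw [h, h]
  simp only [RCLike.inner_apply, conj_trivial]
  have h1 : 1 / √(m : ℝ) * (1 / √(m : ℝ)) = 1 / m := by
    rw [one_div_mul_one_div, Real.mul_self_sqrt (Nat.cast_nonneg m)]
  linear_combination (⟪w i, x⟫_ℝ * ⟪w i, y⟫_ℝ) * h1

namespace IsIsotropicSubgaussianSample

variable {Ω : Type*} [MeasurableSpace Ω] {μ : Measure Ω}
  {d m : ℕ} {c : ℝ≥0} {W : Fin m → Ω → EuclideanSpace ℝ (Fin d)}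

theorem measurable_inner (hW : IsIsotropicSubgaussianSample μ c W) (i : Fin m)
    (x : EuclideanSpace ℝ (Fin d)) : Measurable fun ω => ⟪W i ω, x⟫_ℝ :=
  (hW.measurable i).inner_const

theorem memLp_coord (hW : IsIsotropicSubgaussianSample μ c W) (i : Fin m) (a : Fin d) :
    MemLp (fun ω => W i ω a) 2 μ := by
  have h := (hW.subgaussian i (EuclideanSpace.single a 1) (by simp)).memLp 2
  simpa [EuclideanSpace.inner_single_right] using h

theorem integrable_inner_mul_inner (hW : IsIsotropicSubgaussianSample μ c W) (i : Fin m)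
    (x y : EuclideanSpace ℝ (Fin d)) :
    Integrable (fun ω => ⟪W i ω, x⟫_ℝ * ⟪W i ω, y⟫_ℝ) μ := by
  have h : ∀ x : EuclideanSpace ℝ (Fin d), MemLp (fun ω => ⟪W i ω, x⟫_ℝ) 2 μ := fun x => by
    simp only [PiLp.inner_apply, RCLike.inner_apply, conj_trivial]
    exact memLp_finsetSum _ fun a _ => (hW.memLp_coord i a).const_mul _
  exact (h x).integrable_mul (h y)

theorem integral_inner_mul_inner (hW : IsIsotropicSubgaussianSample μ c W) (i : Fin m)
    (x y : EuclideanSpace ℝ (Fin d)) :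
    ∫ ω, ⟪W i ω, x⟫_ℝ * ⟪W i ω, y⟫_ℝ ∂μ = ⟪x, y⟫_ℝ := by
  have h : ∀ ω, ⟪W i ω, x⟫_ℝ * ⟪W i ω, y⟫_ℝ
      = ∑ a, ∑ b, (x a * y b) * (W i ω a * W i ω b) := fun ω => by
    simp only [PiLp.inner_apply, RCLike.inner_apply, conj_trivial, Finset.sum_mul_sum]
    exact Finset.sum_congr rfl fun a _ => Finset.sum_congr rfl fun b _ => by ring
  have hI : ∀ a b, Integrable (fun ω => (x a * y b) * (W i ω a * W i ω b)) μ := fun a b =>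
    ((hW.memLp_coord i a).integrable_mul (hW.memLp_coord i b)).const_mul _
  simp_rw [h]
  rw [integral_finsetSum _ fun a _ => integrable_finsetSum _ fun b _ => hI a b]
  simp_rw [integral_finsetSum _ fun b _ => hI _ b, integral_const_mul, hW.isotropic]
  simp [Matrix.one_apply, PiLp.inner_apply, mul_comm]

variable [IsProbabilityMeasure μ]

/-- Net points lie in the ball, not on the sphere. Normalizing only enlarges the square; x = 0 uses
1 ≤ √2. -/
theorem lintegral_exp_inner_sq_le (hW : IsIsotropicSubgaussianSample μ c W) (i : Fin m)
    {x : EuclideanSpace ℝ (Fin d)} (hx : ‖x‖ ≤ 1) {b : ℝ} (hb : 0 ≤ b) (hbc : b * c ≤ 1 / 4) :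
    ∫⁻ ω, ENNReal.ofReal (Real.exp (b * ⟪W i ω, x⟫_ℝ ^ 2)) ∂μ ≤ ENNReal.ofReal √2 := by
  by_cases hx0 : x = 0
  · simp [hx0, ENNReal.one_le_ofReal]
  have hn : 0 < ‖x‖ := norm_pos_iff.2 hx0
  have hu : ‖‖x‖⁻¹ • x‖ = 1 := by
    rw [norm_smul, norm_inv, norm_norm, inv_mul_cancel₀ hn.ne']
  refine le_trans (lintegral_mono fun ω => ENNReal.ofReal_le_ofReal (Real.exp_le_exp.2 ?_))
    (lintegral_exp_mul_sq_le (hW.subgaussian i _ hu) (hW.measurable_inner i _) hb hbc)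
  have h1 : ⟪W i ω, x⟫_ℝ = ‖x‖ * ⟪W i ω, ‖x‖⁻¹ • x⟫_ℝ := by
    rw [inner_smul_right]; field_simp
  rw [h1, mul_pow]
  have h2 : ‖x‖ ^ 2 ≤ 1 := pow_le_one₀ hn.le hx
  nlinarith [mul_le_mul_of_nonneg_left h2 (mul_nonneg hb (sq_nonneg ⟪W i ω, ‖x‖⁻¹ • x⟫_ℝ))]

/-- Apply |pq| ≤ (p² + q²)/2 in the exponent, then AM–GM to the exponentials. Removing the mean
costs a factor e since b ≤ 1, and e√2 < 4. -/
theorem exp_abs_inner_mul_inner (hW : IsIsotropicSubgaussianSample μ c W) (i : Fin m)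
    {x y : EuclideanSpace ℝ (Fin d)} (hx : ‖x‖ ≤ 1) (hy : ‖y‖ ≤ 1) {b : ℝ} (hb : 0 < b)
    (hb1 : b ≤ 1) (hbc : b * c ≤ 1 / 4) :
    Integrable (fun ω => Real.exp (b * |⟪W i ω, x⟫_ℝ * ⟪W i ω, y⟫_ℝ - ⟪x, y⟫_ℝ|)) μ ∧
      ∫ ω, Real.exp (b * |⟪W i ω, x⟫_ℝ * ⟪W i ω, y⟫_ℝ - ⟪x, y⟫_ℝ|) ∂μ ≤ 4 := by
  have hxm := hW.measurable_inner i x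
  have hym := hW.measurable_inner i y
  have hsq : ∀ {z : EuclideanSpace ℝ (Fin d)}, ‖z‖ ≤ 1 →
      Integrable (fun ω => Real.exp (b * ⟪W i ω, z⟫_ℝ ^ 2)) μ ∧
        ∫ ω, Real.exp (b * ⟪W i ω, z⟫_ℝ ^ 2) ∂μ ≤ √2 := fun {z} hz => by
    have hzm := hW.measurable_inner i z
    have h := hW.lintegral_exp_inner_sq_le i hz hb.le hbc
    have hI : Integrable (fun ω => Real.exp (b * ⟪W i ω, z⟫_ℝ ^ 2)) μ := by
      refine ⟨(by fun_prop : Measurable _).aestronglyMeasurable, ?_⟩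
      rw [hasFiniteIntegral_iff_ofReal (ae_of_all _ fun _ => (Real.exp_pos _).le)]
      exact h.trans_lt ENNReal.ofReal_lt_top
    refine ⟨hI, ?_⟩
    rw [← ofReal_integral_eq_lintegral_ofReal hI (ae_of_all _ fun _ => (Real.exp_pos _).le)] at h
    exact (ENNReal.ofReal_le_ofReal_iff (Real.sqrt_nonneg 2)).1 h
  obtain ⟨hxI, hxK⟩ := hsq hx
  obtain ⟨hyI, hyK⟩ := hsq hy
  have hle : ∀ ω, Real.exp (b * |⟪W i ω, x⟫_ℝ * ⟪W i ω, y⟫_ℝ - ⟪x, y⟫_ℝ|)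
      ≤ Real.exp 1 * (1 / 2) *
        (Real.exp (b * ⟪W i ω, x⟫_ℝ ^ 2) + Real.exp (b * ⟪W i ω, y⟫_ℝ ^ 2)) := fun ω => by
    have hxy : |⟪x, y⟫_ℝ| ≤ 1 :=
      (abs_real_inner_le_norm x y).trans (mul_le_one₀ hx (norm_nonneg _) hy)
    obtain ⟨p, hp⟩ : ∃ p, p = ⟪W i ω, x⟫_ℝ := ⟨_, rfl⟩
    obtain ⟨q, hq⟩ : ∃ q, q = ⟪W i ω, y⟫_ℝ := ⟨_, rfl⟩
    rw [← hp, ← hq]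
    have h1 : |p * q - ⟪x, y⟫_ℝ| ≤ (p ^ 2 + q ^ 2) / 2 + 1 := by
      have h2 : |p * q| ≤ (p ^ 2 + q ^ 2) / 2 := by
        rw [abs_mul, ← sq_abs p, ← sq_abs q]
        linarith [two_mul_le_add_sq |p| |q|]
      exact (abs_sub _ _).trans (add_le_add h2 hxy)
    have h3 : b * |p * q - ⟪x, y⟫_ℝ| ≤ 1 + (b * p ^ 2 / 2 + b * q ^ 2 / 2) := by
      nlinarith
    have h4 : ∀ u : ℝ, Real.exp (b * u ^ 2) = Real.exp (b * u ^ 2 / 2) ^ 2 := fun u => by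
      rw [← Real.exp_nat_mul]; congr 1; push_cast; ring
    calc Real.exp (b * |p * q - ⟪x, y⟫_ℝ|)
        ≤ Real.exp 1 * (Real.exp (b * p ^ 2 / 2) * Real.exp (b * q ^ 2 / 2)) := by
          rw [← Real.exp_add, ← Real.exp_add]
          exact Real.exp_le_exp.2 h3
      _ ≤ Real.exp 1 * (1 / 2 * (Real.exp (b * p ^ 2) + Real.exp (b * q ^ 2))) := by
          refine mul_le_mul_of_nonneg_left ?_ (Real.exp_pos _).le
          rw [h4 p, h4 q]
          linarith [two_mul_le_add_sq (Real.exp (b * p ^ 2 / 2)) (Real.exp (b * q ^ 2 / 2))]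
      _ = _ := by ring
  have hI : Integrable (fun ω => Real.exp 1 * (1 / 2) *
      (Real.exp (b * ⟪W i ω, x⟫_ℝ ^ 2) + Real.exp (b * ⟪W i ω, y⟫_ℝ ^ 2))) μ :=
    (hxI.add hyI).const_mul _
  have hI' : Integrable
      (fun ω => Real.exp (b * |⟪W i ω, x⟫_ℝ * ⟪W i ω, y⟫_ℝ - ⟪x, y⟫_ℝ|)) μ := by
    refine hI.mono' (by fun_prop : Measurable _).aestronglyMeasurable (ae_of_all _ fun ω => ?_)
    rw [Real.norm_of_nonneg (Real.exp_pos _).le]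
    exact hle ω
  refine ⟨hI', (integral_mono hI' hI hle).trans ?_⟩
  rw [integral_const_mul, integral_add hxI hyI]
  have h1 := Real.exp_one_lt_d9
  have h2 : √2 ≤ 1.42 := by
    rw [Real.sqrt_le_left (by norm_num)]; norm_num
  calc Real.exp 1 * (1 / 2) * (∫ ω, Real.exp (b * ⟪W i ω, x⟫_ℝ ^ 2) ∂μ
        + ∫ ω, Real.exp (b * ⟪W i ω, y⟫_ℝ ^ 2) ∂μ)
      ≤ 2.72 * (1 / 2) * (1.42 + 1.42) := by
        gcongr
        · linarith
        · exact hxK.trans h2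
        · exact hyK.trans h2
    _ ≤ 4 := by norm_num

theorem measureReal_le_abs_sum (hW : IsIsotropicSubgaussianSample μ c W)
    {x y : EuclideanSpace ℝ (Fin d)} (hx : ‖x‖ ≤ 1) (hy : ‖y‖ ≤ 1) {a b : ℝ} (hb : 0 < b)
    (hb1 : b ≤ 1) (hbc : b * c ≤ 1 / 4) (ha : 0 ≤ a) (ha1 : a ≤ 1) :
    μ.real {ω | m * a ≤ |∑ i, (⟪W i ω, x⟫_ℝ * ⟪W i ω, y⟫_ℝ - ⟪x, y⟫_ℝ)|}
      ≤ 2 * Real.exp (-(m * (a ^ 2 * b ^ 2 / 128))) := by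
  have h := measureReal_abs_sum_ge_le (μ := μ)
    (Z := fun i ω => ⟪W i ω, x⟫_ℝ * ⟪W i ω, y⟫_ℝ - ⟪x, y⟫_ℝ)
    (hW.indep.comp (fun _ w => ⟪w, x⟫_ℝ * ⟪w, y⟫_ℝ - ⟪x, y⟫_ℝ) fun _ => by fun_prop)
    (fun i => ((hW.measurable_inner i x).mul (hW.measurable_inner i y)).sub_const _)
    (fun i => (hW.integrable_inner_mul_inner i x y).sub (integrable_const _))
    (fun i => by
      rw [integral_sub (hW.integrable_inner_mul_inner i x y) (integrable_const _),
        hW.integral_inner_mul_inner]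
      simp)
    hb hb1 (by norm_num : (1 : ℝ) ≤ 4) (fun i => (hW.exp_abs_inner_mul_inner i hx hy hb hb1 hbc).1)
    (fun i => (hW.exp_abs_inner_mul_inner i hx hy hb hb1 hbc).2) ha ha1
  norm_num at h ⊢
  exact h

/-- On a subspace `Y`, the sketch preserves all inner products up to `4 a`, outside an event that
is exponentially small in `m a ^ 2` relative to `25 ^ dim Y`. -/
theorem exists_event_subspace (hW : IsIsotropicSubgaussianSample μ c W) (hm : m ≠ 0)
    (Y : Submodule ℝ (EuclideanSpace ℝ (Fin d))) {a b : ℝ} (hb : 0 < b)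
    (hb1 : b ≤ 1) (hbc : b * c ≤ 1 / 4) (ha : 0 ≤ a) (ha1 : a ≤ 1) :
    ∃ B : Set Ω, MeasurableSet B ∧
      μ.real B ≤ 25 ^ Module.finrank ℝ Y * (2 * Real.exp (-(m * (a ^ 2 * b ^ 2 / 128)))) ∧
      ∀ ω ∉ B, ∀ x ∈ Y, ∀ y ∈ Y,
        |⟪toEuclideanLin (sketchMatrix fun i => W i ω) x,
          toEuclideanLin (sketchMatrix fun i => W i ω) y⟫_ℝ - ⟪x, y⟫_ℝ|
            ≤ 4 * a * ‖x‖ * ‖y‖ := by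
  obtain ⟨N, hcard, hN1, hN⟩ := exists_half_net (Y := Y)
  let bad : Y × Y → Set Ω := fun p =>
    {ω | m * a ≤ |∑ i, (⟪W i ω, (p.1 : EuclideanSpace ℝ (Fin d))⟫_ℝ * ⟪W i ω, p.2⟫_ℝ
      - ⟪(p.1 : EuclideanSpace ℝ (Fin d)), p.2⟫_ℝ)|}
  have hbad : ∀ p, MeasurableSet (bad p) := fun p => by
    refine measurableSet_le measurable_const ?_
    have h := fun i => hW.measurable_inner i
    exact (Finset.measurable_fun_sum _ fun i _ => ((h i _).mul (h i _)).sub_const _).abs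
  -- A union bound over pairs of net points, at most 5^dim · 5^dim = 25^dim of them.
  refine ⟨⋃ p ∈ N ×ˢ N, bad p, Finset.measurableSet_biUnion _ fun p _ => hbad p, ?_, ?_⟩
  · calc μ.real (⋃ p ∈ N ×ˢ N, bad p) ≤ ∑ p ∈ N ×ˢ N, μ.real (bad p) :=
          measureReal_biUnion_finset_le _ _
      _ ≤ ∑ _p ∈ N ×ˢ N, 2 * Real.exp (-(m * (a ^ 2 * b ^ 2 / 128))) := by
          refine Finset.sum_le_sum fun p hp => ?_
          rw [Finset.mem_product] at hp
          exact hW.measureReal_le_abs_sum (hN1 _ hp.1) (hN1 _ hp.2) hb hb1 hbc ha ha1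
      _ ≤ _ := by
          rw [Finset.sum_const, nsmul_eq_mul, Finset.card_product]
          gcongr
          have h : (N.card : ℝ) ≤ 5 ^ Module.finrank ℝ Y := by exact_mod_cast hcard
          push_cast
          calc (N.card : ℝ) * N.card ≤ 5 ^ Module.finrank ℝ Y * 5 ^ Module.finrank ℝ Y := by gcongr
            _ = 25 ^ Module.finrank ℝ Y := by rw [← mul_pow]; norm_num
  · intro ω hω x hx y hy
    let T := LinearMap.toContinuousLinearMap (toEuclideanLin (sketchMatrix fun i => W i ω))
    let B : Y →L[ℝ] Y →L[ℝ] ℝ :=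
      ((innerSL ℝ).bilinearComp (T.comp Y.subtypeL) (T.comp Y.subtypeL))
        - (innerSL ℝ).bilinearComp Y.subtypeL Y.subtypeL
    have hB : ∀ p q : Y, B p q = ⟪toEuclideanLin (sketchMatrix fun i => W i ω) p,
        toEuclideanLin (sketchMatrix fun i => W i ω) q⟫_ℝ
          - ⟪(p : EuclideanSpace ℝ (Fin d)), q⟫_ℝ := fun p q => rfl
    have h := abs_bilin_le_of_half_net hN B (a := a) (fun p hp q hq => by
      have h1 : ω ∉ bad (p, q) := fun h => hω
        (Set.mem_biUnion (x := (p, q)) (Finset.mem_product.2 ⟨hp, hq⟩) h)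
      simp only [bad, Set.mem_ofPred_eq, not_le, Finset.sum_sub_distrib, Finset.sum_const,
        Finset.card_univ, Fintype.card_fin, nsmul_eq_mul] at h1
      rw [hB, inner_sketchMatrix]
      have hm0 : (0 : ℝ) < m := by positivity
      rw [← mul_le_mul_iff_right₀ hm0]
      refine le_trans (le_of_eq ?_) h1.le
      rw [← abs_of_pos hm0, ← abs_mul, abs_of_pos hm0]
      congr 1
      field_simp) ⟨x, hx⟩ ⟨y, hy⟩
    rw [hB] at h
    exact h

/-- Simultaneous version of `exists_event_subspace` for finitely many subspaces. -/
theorem exists_event_family (hW : IsIsotropicSubgaussianSample μ c W) (hm : m ≠ 0) {n s : ℕ}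
    (Y : Fin n → Submodule ℝ (EuclideanSpace ℝ (Fin d))) (hY : ∀ j, Module.finrank ℝ (Y j) ≤ s)
    {a b δ : ℝ} (hb : 0 < b) (hb1 : b ≤ 1) (hbc : b * c ≤ 1 / 4) (ha : 0 ≤ a) (ha1 : a ≤ 1)
    (hδ : n * (25 ^ s * (2 * Real.exp (-(m * (a ^ 2 * b ^ 2 / 128))))) ≤ δ) :
    ∃ E : Set Ω, MeasurableSet E ∧ ENNReal.ofReal (1 - δ) ≤ μ E ∧
      ∀ ω ∈ E, ∀ j, ∀ x ∈ Y j, ∀ y ∈ Y j,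
        |⟪toEuclideanLin (sketchMatrix fun i => W i ω) x,
          toEuclideanLin (sketchMatrix fun i => W i ω) y⟫_ℝ - ⟪x, y⟫_ℝ|
            ≤ 4 * a * ‖x‖ * ‖y‖ := by
  choose B hBm hBμ hB using fun j => hW.exists_event_subspace hm (Y j) hb hb1 hbc ha ha1
  have hU : MeasurableSet (⋃ j, B j) := MeasurableSet.iUnion hBm
  refine ⟨(⋃ j, B j)ᶜ, hU.compl, ?_, ?_⟩
  · rw [← ofReal_measureReal]
    refine ENNReal.ofReal_le_ofReal ?_
    rw [probReal_compl_eq_one_sub hU]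
    have h : μ.real (⋃ j, B j)
        ≤ ∑ _j : Fin n, 25 ^ s * (2 * Real.exp (-(m * (a ^ 2 * b ^ 2 / 128)))) := by
      refine (measureReal_iUnion_fintype_le _).trans (Finset.sum_le_sum fun j _ => ?_)
      refine (hBμ j).trans ?_
      gcongr
      · norm_num
      · exact hY j
    rw [Finset.sum_const, Finset.card_univ, Fintype.card_fin, nsmul_eq_mul] at h
    linarith
  · intro ω hω j
    exact hB j ω fun h => hω (Set.mem_iUnion.2 ⟨j, h⟩)

end IsIsotropicSubgaussianSample

/-! ### Choice of constants and conclusion -/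

theorem finrank_rangeOf {d : ℕ} (F : Matrix (Fin d) (Fin d) ℝ) :
    Module.finrank ℝ (rangeOf F) = F.rank := by
  rw [F.rank_eq_finrank_range_toLin (PiLp.basisFun 2 ℝ (Fin d)) (PiLp.basisFun 2 ℝ (Fin d)),
    ← toLpLin_eq_toLin]
  rfl

/-- The union bound over `n` nets of dimension `s` is met once `m` dominates its logarithm. -/
theorem union_bound_le {n s m : ℕ} {δ ε b : ℝ} (hn : n ≠ 0) (hε : 0 < ε) (hb : 0 < b)
    (hδ : 0 < δ)
    (hm : (1 + 4 * s + Real.log (n / δ)) * (8192 / (ε ^ 2 * b ^ 2)) ≤ m) :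
    n * (25 ^ s * (2 * Real.exp (-(m * ((ε / 8) ^ 2 * b ^ 2 / 128))))) ≤ δ := by
  have hn0 : (0 : ℝ) < n := by positivity
  -- Here 8192 = 64 · 128. The summands 1 and 4 s pay for 2 ≤ e and 25^s ≤ e^(4s).
  have h1 : 1 + 4 * s + Real.log (n / δ) ≤ m * ((ε / 8) ^ 2 * b ^ 2 / 128) := by
    calc _ = (1 + 4 * s + Real.log (n / δ)) * (8192 / (ε ^ 2 * b ^ 2))
          * ((ε / 8) ^ 2 * b ^ 2 / 128) := by field_simp; ring
      _ ≤ _ := by gcongr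
  have h25 : (25 : ℝ) ≤ Real.exp 4 := by
    have h := Real.exp_one_gt_d9
    have h2 : Real.exp 4 = Real.exp 1 ^ 4 := by rw [← Real.exp_nat_mul]; norm_num
    rw [h2]
    calc (25 : ℝ) ≤ 2.7 ^ 4 := by norm_num
      _ ≤ _ := by gcongr; linarith
  have h2 : (2 : ℝ) ≤ Real.exp 1 := by linarith [Real.exp_one_gt_d9]
  calc n * (25 ^ s * (2 * Real.exp (-(m * ((ε / 8) ^ 2 * b ^ 2 / 128)))))
      ≤ n * (Real.exp 4 ^ s * (Real.exp 1 * Real.exp (-(1 + 4 * s + Real.log (n / δ))))) := by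
        gcongr
    _ = n * (Real.exp (-Real.log (n / δ))) := by
        rw [← Real.exp_nat_mul, ← Real.exp_add, ← Real.exp_add]
        congr 2
        ring
    _ = δ := by
        rw [Real.exp_neg, Real.exp_log (by positivity)]
        field_simp

theorem theorem6 (c : ℝ≥0) :
    ∃ C : ℝ, 0 < C ∧
      ∀ {Ω : Type*} [MeasurableSpace Ω] (μ : Measure Ω) [IsProbabilityMeasure μ]
        (d m k : ℕ) (F : Matrix (Fin d) (Fin d) ℝ) (_hF : F.PosSemidef)
        (W : Fin m → Ω → EuclideanSpace ℝ (Fin d))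
        (_hW : IsIsotropicSubgaussianSample μ c W)
        (g' : Fin k → EuclideanSpace ℝ (Fin d))
        (ε δ : ℝ) (_hε : 0 < ε ∧ ε < 1) (_hδ : 0 < δ ∧ δ < 1)
        (k' : ℕ)
        (_hk' : k' = Module.finrank ℝ
          (Submodule.span ℝ (Set.range fun j => kerComponent F (g' j))))
        (_hm : C * ((F.rank + min (Real.log (k / δ)) (k' + Real.log (1 / δ))) / ε ^ 2) ≤ m),
        ∃ E : Set Ω, MeasurableSet E ∧ ENNReal.ofReal (1 - δ) ≤ μ E ∧
          ∀ ω ∈ E, ∀ g ∈ rangeOf F, ∀ j : Fin k,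
            |sketchedInfluence F (sketchMatrix fun i => W i ω) 0 g (kerComponent F (g' j))|
                ≤ ε * (‖g‖ * ‖kerComponent F (g' j)‖ / minPosEigenvalue F) ∧
            ∀ lam : ℝ, 0 < lam →
              |sketchedInfluence F (sketchMatrix fun i => W i ω) lam g (kerComponent F (g' j))|
                ≤ ε * ‖g‖ * ‖kerComponent F (g' j)‖ *
                    (1 / lam + 2 * spectralNorm2 F / lam ^ 2) := by
  -- The shift c + 1 secures both b ≤ 1 and b c ≤ 1/4, even for c = 0.
  obtain ⟨b, hbdef⟩ : ∃ b : ℝ, b = 1 / (4 * (c + 1)) := ⟨_, rfl⟩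
  have hc : (0 : ℝ) ≤ c := c.2
  have hb : 0 < b := by rw [hbdef]; positivity
  have hb1 : b ≤ 1 := by
    rw [hbdef, div_le_one (by positivity)]; linarith
  have hbc : b * c ≤ 1 / 4 := by
    rw [hbdef, div_mul_eq_mul_div, div_le_div_iff₀ (by positivity) (by norm_num)]; linarith
  -- The 9 covers the worse case s = r + 1: for r ≥ 1, 1 + 4(r + 1) ≤ 9 r. Rank 0 is therefore
  -- treated apart, where g = 0.
  refine ⟨9 * 8192 / b ^ 2, by positivity, ?_⟩
  intro Ω _ μ _ d m k F hF W hW g' ε δ ⟨hε0, hε1⟩ ⟨hδ0, hδ1⟩ k' hk' hm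
  have hker : ∀ j, kerComponent F (g' j) ∈ kerOf F := fun j =>
    Submodule.starProjection_apply_mem _ _
  have hlogδ : 0 < Real.log (1 / δ) := Real.log_pos (by rw [lt_div_iff₀ hδ0]; linarith)
  by_cases hr : F.rank = 0
  · refine ⟨Set.univ, MeasurableSet.univ, ?_, fun ω _ g hg j => ?_⟩
    · rw [measure_univ]
      exact ENNReal.ofReal_le_one.2 (by linarith)
    · rw [← finrank_rangeOf, Submodule.finrank_eq_zero] at hr
      rw [hr, Submodule.mem_bot] at hg
      simp [hg, sketchedInfluence]
  by_cases hk : k = 0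
  · subst hk
    refine ⟨Set.univ, MeasurableSet.univ, ?_, fun ω _ g hg j => j.elim0⟩
    rw [measure_univ]
    exact ENNReal.ofReal_le_one.2 (by linarith)
  have hr1 : (1 : ℝ) ≤ F.rank := by exact_mod_cast Nat.one_le_iff_ne_zero.2 hr
  have hk1 : (1 : ℝ) ≤ k := by exact_mod_cast Nat.one_le_iff_ne_zero.2 hk
  have hlogk : Real.log (1 / δ) ≤ Real.log (k / δ) := by gcongr
  have hmin : 0 < min (Real.log (k / δ)) (k' + Real.log (1 / δ)) :=
    lt_min (by linarith) (by positivity)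
  have hm0 : m ≠ 0 := by
    rintro rfl
    have : 0 < 9 * 8192 / b ^ 2
        * ((F.rank + min (Real.log (k / δ)) (k' + Real.log (1 / δ))) / ε ^ 2) := by positivity
    rw [Nat.cast_zero] at hm
    linarith
  -- It suffices to cover `range F` and the vectors `kerComponent F (g' j)` by few subspaces.
  have key : ∀ (n s : ℕ) (Y : Fin n → Submodule ℝ (EuclideanSpace ℝ (Fin d))) (f : Fin k → Fin n),
      n ≠ 0 → (∀ j, Module.finrank ℝ (Y j) ≤ s) → (∀ j, rangeOf F ≤ Y j) →
      (∀ j, kerComponent F (g' j) ∈ Y (f j)) →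
      1 + 4 * s + Real.log (n / δ)
        ≤ 9 * (F.rank + min (Real.log (k / δ)) (k' + Real.log (1 / δ))) →
      ∃ E : Set Ω, MeasurableSet E ∧ ENNReal.ofReal (1 - δ) ≤ μ E ∧
        ∀ ω ∈ E, ∀ g ∈ rangeOf F, ∀ j : Fin k,
          |sketchedInfluence F (sketchMatrix fun i => W i ω) 0 g (kerComponent F (g' j))|
              ≤ ε * (‖g‖ * ‖kerComponent F (g' j)‖ / minPosEigenvalue F) ∧
          ∀ lam : ℝ, 0 < lam →
            |sketchedInfluence F (sketchMatrix fun i => W i ω) lam g (kerComponent F (g' j))|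
              ≤ ε * ‖g‖ * ‖kerComponent F (g' j)‖ *
                  (1 / lam + 2 * spectralNorm2 F / lam ^ 2) := by
    intro n s Y f hn hYs hYr hYf hle
    have hbound := union_bound_le (m := m) hn hε0 hb hδ0 (s := s) (by
      refine le_trans ?_ hm
      calc _ ≤ 9 * (F.rank + min (Real.log (k / δ)) (k' + Real.log (1 / δ)))
            * (8192 / (ε ^ 2 * b ^ 2)) := by gcongr
        _ = _ := by field_simp)
    -- `hbound` fixes a = ε/8, so the net factor 4 leaves distortion ε/2.
    obtain ⟨E, hEm, hE, h⟩ := hW.exists_event_family hm0 Y hYs hb hb1 hbc (by positivity)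
      (by linarith) hbound
    refine ⟨E, hEm, hE, fun ω hω g hg j => ?_⟩
    refine abs_sketchedInfluence_le hF hε0 hε1 (hYr (f j)) (fun x hx y hy => ?_) hg (hYf j) (hker j)
    have h1 := h ω hω (f j) x hx y hy
    rwa [show 4 * (ε / 8) = ε / 2 by ring] at h1
  -- If the minimum is log(k/δ), use one subspace per j; otherwise a single subspace contains every
  -- kernel component.
  rcases min_choice (Real.log (k / δ)) (k' + Real.log (1 / δ)) with h | h
  · refine key k (F.rank + 1) (fun j => rangeOf F ⊔ Submodule.span ℝ {kerComponent F (g' j)}) id hk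
      (fun j => ?_) (fun j => le_sup_left)
      (fun j => Submodule.mem_sup_right (Submodule.mem_span_singleton_self _)) ?_
    · refine (Submodule.finrank_add_le_finrank_add_finrank _ _).trans ?_
      rw [finrank_rangeOf]
      gcongr
      exact (finrank_span_le_card _).trans (by simp)
    · rw [h]
      push_cast
      linarith
  · refine key 1 (F.rank + k')
      (fun _ => rangeOf F ⊔ Submodule.span ℝ (Set.range fun j => kerComponent F (g' j)))
      (fun _ => 0) one_ne_zero (fun j => ?_) (fun j => le_sup_left)
      (fun j => Submodule.mem_sup_right (Submodule.subset_span ⟨j, rfl⟩)) ?_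
    · refine (Submodule.finrank_add_le_finrank_add_finrank _ _).trans ?_
      rw [finrank_rangeOf, hk']
    · rw [h]
      push_cast
      have : (0 : ℝ) ≤ k' := Nat.cast_nonneg _
      linarith
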